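/- Let $\mathfrak g$ be a finite-dimensional simple Lie algebra over $\mathbb C$ with a Cartan subalgebra $\mathfrak h$ and a fixed choice of simple roots $\alpha_1,\dots,\alpha_\ell\in\mathfrak h^*$ with simple coroots $\alpha_1^\vee,\dots,\alpha_\ell^\vee\in\mathfrak h$. Let $Q=\mathbb Z\alpha_1+\cdots+\mathbb Z\alpha_\ell$ be the root lattice, and let $P_+=\{\lambda\in\mathfrak h^* : \lambda(\alpha_i^\vee)\in\mathbb Z_{\ge 0}\text{ for } 1\le i\le\ell\}$ be the set of dominant integral weights. For $\lambda\in P_+$ let $L(\lambda)$ be the finite-dimensional irreducible $\mathfrak g$-module with highest weight $\lambda$ (unique up to isomorphism), and let $\mathrm{wt}(\lambda)\subseteq\mathfrak h^*$ be the set of its weights, i.e. of all $\mu\in\mathfrak h^*$ for which some nonzero $v\in L(\lambda)$ satisfies $hv=\mu(h)v$ for all $h\in\mathfrak h$. Let $\lambda\in P_+$ with $\lambda\neq 0$, and let $n_1<n_2<\cdots$ be a strictly increasing sequence of positive integers such that $n_i\lambda\in\lambda+Q$ for all $i$. Then $$\mathrm{wt}(n_1\lambda)\subseteq\mathrm{wt}(n_2\lambda)\subseteq\cdots\qquad\text{and}\qquad\bigcup_{i\ge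 1}\mathrm{wt}(n_i\lambda)=\lambda+Q.$$ -/

import Mathlib

open Module

section HighestWeight

/-- The weights `wt(V)` of a `𝔤`-module `V` with respect to the subalgebra `H`: the linear forms `μ`
on `H` for which there is a nonzero vector `v` in `V` with `⁅h, v⁆ = μ h • v` for all `h` in `H`. -/
def weightSet {𝔤 : Type*} [LieRing 𝔤] [LieAlgebra ℂ 𝔤]
    (H : LieSubalgebra ℂ 𝔤) [LieRing.IsNilpotent H]
    (V : Type*) [AddCommGroup V] [Module ℂ V] [LieRingModule 𝔤 V] [LieModule ℂ 𝔤 V] :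
    Set (Dual ℂ H) :=
  {μ | LieModule.weightSpace V (μ : H → ℂ) ≠ ⊥}

variable {𝔤 : Type*} [LieRing 𝔤] [LieAlgebra ℂ 𝔤] [FiniteDimensional ℂ 𝔤] [LieAlgebra.IsKilling ℂ 𝔤]
  {H : LieSubalgebra ℂ 𝔤} [H.IsCartanSubalgebra]

/-- Dominant integral weights (the set `P₊`): the linear forms on `H` taking non-negative integer
values on all simple coroots. -/
def IsDominantIntegral (b : (LieAlgebra.IsKilling.rootSystem H).Base) (l : Dual ℂ H) : Prop :=
  ∀ i ∈ b.support, ∃ k : ℕ, l ((LieAlgebra.IsKilling.rootSystem H).coroot i) = (k : ℂ)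

/-- `V` is (a copy of) `L(l)`, the finite-dimensional irreducible `𝔤`-module of highest weight `l`:
it is finite-dimensional and irreducible, and it contains a nonzero vector of weight `l` that is
annihilated by the root spaces of all positive roots. -/
structure IsIrreducibleOfHighestWeight (b : (LieAlgebra.IsKilling.rootSystem H).Base)
    (l : Dual ℂ H)
    (V : Type*) [AddCommGroup V] [Module ℂ V] [LieRingModule 𝔤 V] [LieModule ℂ 𝔤 V] : Prop where
  finiteDimensional : FiniteDimensional ℂ V
  irreducible : LieModule.IsIrreducible ℂ 𝔤 V
  exists_highestWeightVector : ∃ v : V, v ≠ 0 ∧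
    (∀ h : H, ⁅(h : 𝔤), v⁆ = l h • v) ∧
    ∀ i : H.root, b.IsPos i →
      ∀ e ∈ LieAlgebra.rootSpace H ((LieAlgebra.IsKilling.rootSystem H).root i), ⁅e, v⁆ = 0

/-- The coset `l + Q` of the root lattice `Q`, the `ℤ`-span of the roots. -/
def rootLatticeCoset (H : LieSubalgebra ℂ 𝔤) [H.IsCartanSubalgebra] (l : Dual ℂ H) :
    Set (Dual ℂ H) :=
  {μ | μ - l ∈ (LieAlgebra.IsKilling.rootSystem H).rootSpan ℤ}

end HighestWeight

/-! The weights of a finite-dimensional module are stable under the Weyl group, and every integral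
weight is conjugate to a dominant one, so it suffices to compare dominant weights. A dominant `μ` is
a weight of the irreducible module with highest weight `l` exactly when `l - μ` is a non-negative
integral combination of simple roots (`highestWeight_sub_mem_closure`,
`mem_weightSet_of_isDominantIntegral`).

For `m ≤ n`, the difference `n • l - m • l` is dominant; lying in the root lattice, it is such a
combination (`nonneg_of_vecMul_cartanMatrix_nonneg`), which gives the chain. Simplicity makes a
nonzero dominant element of the root lattice strictly positive on every simple root
(`pos_of_vecMul_cartanMatrix_nonneg`), so far enough along the sequence the highest weight lies
above any prescribed dominant weight of the coset. This gives the union. -/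

/-! ### Weight strings from `sl₂`-triples -/

section WeightSet

open LieModule LieAlgebra LieAlgebra.IsKilling

variable {𝔤 : Type*} [LieRing 𝔤] [LieAlgebra ℂ 𝔤]

lemma mem_weightSet_iff {H : LieSubalgebra ℂ 𝔤} [LieRing.IsNilpotent H]
    {V : Type*} [AddCommGroup V] [Module ℂ V] [LieRingModule 𝔤 V] [LieModule ℂ 𝔤 V]
    {μ : Dual ℂ H} :
    μ ∈ weightSet H V ↔ ∃ v : V, v ≠ 0 ∧ ∀ h : H, ⁅(h : 𝔤), v⁆ = μ h • v := by
  simp only [weightSet, Set.mem_ofPred_eq, ne_eq, LieSubmodule.eq_bot_iff, mem_weightSpace]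
  push Not
  exact ⟨fun ⟨v, h, h'⟩ ↦ ⟨v, h', h⟩, fun ⟨v, h, h'⟩ ↦ ⟨v, h', h⟩⟩

lemma mem_weightSet_of_mem_genWeightSpace {H : LieSubalgebra ℂ 𝔤} [LieRing.IsNilpotent H]
    {V : Type*} [AddCommGroup V] [Module ℂ V] [LieRingModule 𝔤 V] [LieModule ℂ 𝔤 V]
    [FiniteDimensional ℂ V] {μ : Dual ℂ H} {v : V} (hv : v ∈ genWeightSpace V (μ : H → ℂ))
    (hv0 : v ≠ 0) : μ ∈ weightSet H V := by
  let χ : LieModule.Weight ℂ H V := ⟨μ, fun h ↦ hv0 (by simpa [h] using hv)⟩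
  exact mem_weightSet_iff.mpr (exists_forall_lie_eq_smul ℂ H V χ)

variable {H : LieSubalgebra ℂ 𝔤} [LieRing.IsNilpotent H]
  {V : Type*} [AddCommGroup V] [Module ℂ V] [LieRingModule 𝔤 V] [LieModule ℂ 𝔤 V]
  [FiniteDimensional ℂ V]

/-- Raising a weight vector as far as possible produces a primitive vector, and all vectors obtained
by lowering it again are nonzero. -/
lemma exists_int_and_sub_nsmul_mem_weightSet {α μ : Dual ℂ H} (hα : α ≠ 0) {h : H} {e f : 𝔤}
    (t : IsSl2Triple (h : 𝔤) e f) (he : e ∈ rootSpace H α) (hf : f ∈ rootSpace H (-α))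
    (hμ : μ ∈ weightSet H V) :
    ∃ m : ℤ, μ h = m ∧ ∀ k : ℕ, k ≤ m → μ - k • α ∈ weightSet H V := by
  obtain ⟨v, hv0, hv⟩ := mem_weightSet_iff.mp hμ
  have hvg : v ∈ genWeightSpace V (μ : H → ℂ) :=
    weightSpace_le_genWeightSpace V _ ((mem_weightSpace _ v).mpr hv)
  obtain ⟨n, hn⟩ := isNilpotent_toEnd_of_mem_rootSpace (M := V) H
    (fun h0 ↦ hα (DFunLike.coe_injective h0)) he
  obtain ⟨p, hp, hp'⟩ : ∃ p, (toEnd ℂ 𝔤 V e ^ p) v ≠ 0 ∧ (toEnd ℂ 𝔤 V e ^ (p + 1)) v = 0 :=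
    Nat.exists_not_and_succ_of_not_zero_of_exists (by simpa using hv0) ⟨n, by simp [hn]⟩
  have P : t.HasPrimitiveVectorWith ((toEnd ℂ 𝔤 V e ^ p) v) (μ h + 2 * p) :=
    ⟨hp, t.lie_h_pow_toEnd_e (hv h) p, by rwa [IsSl2Triple.lie_e_pow_toEnd_e]⟩
  obtain ⟨N, hN⟩ := P.exists_nat
  -- The primitive vector has `h`-weight `N = m + 2p`, so it survives `p + k ≤ N` lowerings: `p` of
  -- them return to `μ` and `k` more reach `μ - k • α`.
  refine ⟨N - 2 * p, by push_cast; rw [← hN]; ring, fun k hk ↦ ?_⟩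
  refine mem_weightSet_of_mem_genWeightSpace (v := (toEnd ℂ 𝔤 V f ^ (p + k))
    ((toEnd ℂ 𝔤 V e ^ p) v)) ?_ (P.pow_toEnd_f_ne_zero_of_eq_nat hN (by omega))
  have hk : ((μ - k • α : Dual ℂ H) : H → ℂ) = (p + k) • (-α : H → ℂ) + (p • (α : H → ℂ) + μ) := by
    ext x
    simp
    ring
  rw [hk]
  exact toEnd_pow_apply_mem hf (toEnd_pow_apply_mem he hvg p) (p + k)

end WeightSet

/-! ### Weyl group invariance of the weights -/

section Killing

open LieModule LieAlgebra LieAlgebra.IsKilling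

variable {𝔤 : Type*} [LieRing 𝔤] [LieAlgebra ℂ 𝔤] [FiniteDimensional ℂ 𝔤] [LieAlgebra.IsKilling ℂ 𝔤]
  {H : LieSubalgebra ℂ 𝔤} [H.IsCartanSubalgebra]
  {V : Type*} [AddCommGroup V] [Module ℂ V] [LieRingModule 𝔤 V] [LieModule ℂ 𝔤 V]
  [FiniteDimensional ℂ V]

lemma exists_int_and_sub_nsmul_root_mem_weightSet (i : H.root) {μ : Dual ℂ H}
    (hμ : μ ∈ weightSet H V) :
    ∃ m : ℤ, μ ((rootSystem H).coroot i) = m ∧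
      (∀ k : ℕ, k ≤ m → μ - k • (rootSystem H).root i ∈ weightSet H V) ∧
      (∀ k : ℕ, k ≤ -m → μ + k • (rootSystem H).root i ∈ weightSet H V) := by
  have hi : (i : Weight ℂ H 𝔤).IsNonZero := H.isNonZero_coe_root i
  obtain ⟨h, e, f, t, he, hf⟩ := exists_isSl2Triple_of_weight_isNonZero hi
  obtain rfl := t.h_eq_coroot hi he hf
  have h0 := (rootSystem H).ne_zero i
  obtain ⟨m, hm, hm'⟩ := exists_int_and_sub_nsmul_mem_weightSet h0 t he hf hμ
  -- The opposite triple gives the string in the direction of `+α`.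
  have t' : IsSl2Triple ((-coroot (i : Weight ℂ H 𝔤) : H) : 𝔤) f e := by simpa using t.symm
  obtain ⟨m', hm₁, hm₁'⟩ := exists_int_and_sub_nsmul_mem_weightSet (neg_ne_zero.mpr h0) t' hf
    (by simpa using he) hμ
  have hmm : m' = -m := by
    rw [map_neg, hm] at hm₁
    exact_mod_cast hm₁.symm
  refine ⟨m, hm, hm', fun k hk ↦ ?_⟩
  simpa using hm₁' k (by omega)

lemma reflection_mem_weightSet (i : H.root) {μ : Dual ℂ H} (hμ : μ ∈ weightSet H V) :
    (rootSystem H).reflection i μ ∈ weightSet H V := by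
  obtain ⟨m, hm, h₁, h₂⟩ := exists_int_and_sub_nsmul_root_mem_weightSet i hμ
  have key : (rootSystem H).reflection i μ = μ - m • (rootSystem H).root i := by
    rw [RootPairing.reflection_apply, ← Int.cast_smul_eq_zsmul ℂ, ← hm]
    rfl
  rw [key]
  rcases Int.natAbs_eq m with h | h
  · have := h₁ m.natAbs (by omega)
    rwa [← natCast_zsmul, ← h] at this
  · have := h₂ m.natAbs (by omega)
    rwa [← natCast_zsmul, ← sub_neg_eq_add, ← neg_smul, ← h] at this

lemma weylGroup_smul_mem_weightSet (w : (rootSystem H).weylGroup) {μ : Dual ℂ H}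
    (hμ : μ ∈ weightSet H V) : w • μ ∈ weightSet H V := by
  obtain ⟨w, hw⟩ := w
  induction hw using RootPairing.weylGroup.induction generalizing μ with
  | mem i => exact reflection_mem_weightSet i hμ
  | one => simpa using hμ
  | mul x y hx hy ihx ihy =>
    have := ihx (ihy hμ)
    rwa [← mul_smul] at this

lemma sub_root_mem_weightSet (i : H.root) {μ : Dual ℂ H} (hμ : μ ∈ weightSet H V) {m : ℤ}
    (hm : μ ((rootSystem H).coroot i) = m) (hm0 : 0 < m) :
    μ - (rootSystem H).root i ∈ weightSet H V := by
  obtain ⟨m', hm', h₁, -⟩ := exists_int_and_sub_nsmul_root_mem_weightSet i hμ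
  obtain rfl : m = m' := by exact_mod_cast hm.symm.trans hm'
  simpa using h₁ 1 (by omega)

end Killing

/-! ### Weights lie below the highest weight -/

section HighestWeightModule

open LieModule LieAlgebra LieAlgebra.IsKilling

variable {𝔤 : Type*} [LieRing 𝔤] [LieAlgebra ℂ 𝔤] [FiniteDimensional ℂ 𝔤] [LieAlgebra.IsKilling ℂ 𝔤]
  {H : LieSubalgebra ℂ 𝔤} [H.IsCartanSubalgebra] {b : (rootSystem H).Base} {l : Dual ℂ H}
  {V : Type*} [AddCommGroup V] [Module ℂ V] [LieRingModule 𝔤 V] [LieModule ℂ 𝔤 V]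

lemma highestWeight_mem_weightSet (hV : IsIrreducibleOfHighestWeight b l V) :
    l ∈ weightSet H V := by
  obtain ⟨v, hv0, hv, -⟩ := hV.exists_highestWeightVector
  exact mem_weightSet_iff.mpr ⟨v, hv0, hv⟩

/-- A subspace of an irreducible module which contains a highest weight vector and is stable under
the root spaces of all negative roots is everything. -/
lemma Submodule.eq_top_of_forall_lie_negative_mem [LieModule.IsIrreducible ℂ 𝔤 V]
    {v : V} (hv0 : v ≠ 0) (hv : ∀ h : H, ⁅(h : 𝔤), v⁆ = l h • v)
    (hpos : ∀ i : H.root, b.IsPos i → ∀ e ∈ rootSpace H ((rootSystem H).root i), ⁅e, v⁆ = 0)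
    {N : Submodule ℂ V} (hvN : v ∈ N)
    (hN : ∀ i : H.root, b.IsPos i → ∀ f ∈ rootSpace H (-(rootSystem H).root i : Dual ℂ H),
      ∀ w ∈ N, ⁅f, w⁆ ∈ N) : N = ⊤ := by
  let S : Set (Submodule ℂ V) := {N | v ∈ N ∧ ∀ i : H.root, b.IsPos i →
    ∀ f ∈ rootSpace H (-(rootSystem H).root i : Dual ℂ H), ∀ w ∈ N, ⁅f, w⁆ ∈ N}
  have hNS : N ∈ S := ⟨hvN, hN⟩
  -- `N` itself need not be a Lie submodule, but the smallest member of `S` is.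
  let N₀ := sInf S
  have hv₀ : v ∈ N₀ := Submodule.mem_sInf.mpr fun N hN ↦ hN.1
  have hf₀ : ∀ i : H.root, b.IsPos i → ∀ f ∈ rootSpace H (-(rootSystem H).root i : Dual ℂ H),
      ∀ w ∈ N₀, ⁅f, w⁆ ∈ N₀ := fun i hi f hf w hw ↦
    Submodule.mem_sInf.mpr fun N hN ↦ hN.2 i hi f hf w (Submodule.mem_sInf.mp hw N hN)
  have hx₀ (x : 𝔤) : ⁅x, v⁆ ∈ N₀ := by
    have hx : x ∈ ⨆ χ : Weight ℂ H 𝔤, rootSpace H χ := by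
      simp [iSup_genWeightSpace_eq_top' ℂ H 𝔤]
    induction hx using LieSubmodule.iSup_induction' with
    | zero => simp
    | add x y _ _ hx hy => rw [add_lie]; exact N₀.add_mem hx hy
    | mem χ x hx =>
      by_cases hχ : χ.IsZero
      · rw [hχ.eq, rootSpace_zero_eq] at hx
        rw [hv ⟨x, hx⟩]
        exact N₀.smul_mem _ hv₀
      · let i : H.root := ⟨χ, by simpa using hχ⟩
        let := (rootSystem H).indexNeg
        rcases RootPairing.Base.IsPos.or_neg b i with hi | hi
        · rw [hpos i hi x hx]
          exact N₀.zero_mem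
        · refine hf₀ (-i) hi x ?_ v hv₀
          have : (rootSystem H).root (-i) = -(rootSystem H).root i := by
            rw [RootPairing.indexNeg_neg, RootPairing.root_reflectionPerm,
              RootPairing.reflection_apply_self]
          rw [this, neg_neg]
          exact hx
  -- By the Jacobi identity `N₁` is again in `S`, so minimality forces `N₀ ≤ N₁`: all of `𝔤`
  -- preserves `N₀`.
  let N₁ : Submodule ℂ V :=
    { carrier := {w | w ∈ N₀ ∧ ∀ x : 𝔤, ⁅x, w⁆ ∈ N₀}
      add_mem' := fun ha hb ↦ ⟨N₀.add_mem ha.1 hb.1, fun x ↦ by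
        rw [lie_add]; exact N₀.add_mem (ha.2 x) (hb.2 x)⟩
      zero_mem' := ⟨N₀.zero_mem, fun x ↦ by simp⟩
      smul_mem' := fun c w hw ↦ ⟨N₀.smul_mem c hw.1, fun x ↦ by
        rw [lie_smul]; exact N₀.smul_mem c (hw.2 x)⟩ }
  have hN₁ : N₁ ∈ S := by
    refine ⟨⟨hv₀, hx₀⟩, fun i hi f hf w hw ↦ ⟨hw.2 f, fun x ↦ ?_⟩⟩
    rw [leibniz_lie]
    exact N₀.add_mem (hw.2 _) (hf₀ i hi f hf _ (hw.2 x))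
  let N' : LieSubmodule ℂ 𝔤 V := { N₀ with lie_mem := fun {x w} hw ↦ (sInf_le hN₁ hw).2 x }
  have hN' : N' = ⊤ := by
    refine (eq_bot_or_eq_top N').resolve_left fun h ↦ hv0 ?_
    have : v ∈ N' := hv₀
    simpa [h] using this
  rw [eq_top_iff]
  intro w _
  have : w ∈ N' := hN' ▸ LieSubmodule.mem_top w
  exact sInf_le (a := N) hNS this

lemma root_mem_closure_of_isPos {i : H.root} (hi : b.IsPos i) :
    (rootSystem H).root i ∈ AddSubmonoid.closure ((rootSystem H).root '' b.support) :=
  hi.induction_on_add (p := fun i ↦ (rootSystem H).root i ∈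
      AddSubmonoid.closure ((rootSystem H).root '' b.support))
    (fun j hj ↦ AddSubmonoid.subset_closure ⟨j, hj, rfl⟩)
    (fun _ j _ h hp hj ↦ h ▸ add_mem hp (AddSubmonoid.subset_closure ⟨j, hj, rfl⟩))

/-- The generalized weight spaces for weights below `l` span a subspace stable under lowering, hence
everything; independence of weight spaces excludes any other weight. -/
lemma highestWeight_sub_mem_closure (hV : IsIrreducibleOfHighestWeight b l V) {μ : Dual ℂ H}
    (hμ : μ ∈ weightSet H V) :
    l - μ ∈ AddSubmonoid.closure ((rootSystem H).root '' b.support) := by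
  have := hV.finiteDimensional
  have := hV.irreducible
  obtain ⟨v, hv0, hv, hpos⟩ := hV.exists_highestWeightVector
  let Q := AddSubmonoid.closure ((rootSystem H).root '' b.support)
  let W : LieSubmodule ℂ H V := ⨆ q : Q, genWeightSpace V (l - q : Dual ℂ H)
  have hW : W.toSubmodule = ⊤ := by
    refine Submodule.eq_top_of_forall_lie_negative_mem (b := b) hv0 hv hpos ?_ ?_
    · refine LieSubmodule.mem_iSup_of_mem (0 : Q) ?_
      simp only [ZeroMemClass.coe_zero, sub_zero]
      exact weightSpace_le_genWeightSpace V _ ((mem_weightSpace _ v).mpr hv)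
    · intro i hi f hf w hw
      replace hw : w ∈ W := hw
      change ⁅f, w⁆ ∈ W
      induction hw using LieSubmodule.iSup_induction' with
      | zero => simp
      | add x y _ _ hx hy => rw [lie_add]; exact W.add_mem hx hy
      | mem q w hw =>
        refine LieSubmodule.mem_iSup_of_mem (q + ⟨_, root_mem_closure_of_isPos hi⟩ : Q) ?_
        have hq : ((l - (q + ⟨_, root_mem_closure_of_isPos hi⟩ : Q) : Dual ℂ H) : H → ℂ) =
            (-(rootSystem H).root i : Dual ℂ H) + (l - q : Dual ℂ H) := by
          ext x
          simp
          ring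
        rw [hq]
        exact lie_mem_genWeightSpace_of_mem_genWeightSpace hf hw
  by_contra hc
  have hind := iSupIndep_genWeightSpace ℂ H V (μ : H → ℂ)
  have hle : W ≤ ⨆ χ, ⨆ (_ : χ ≠ (μ : H → ℂ)), genWeightSpace V χ := by
    refine iSup_le fun q ↦ le_iSup₂_of_le ((l - q : Dual ℂ H) : H → ℂ) (fun h ↦ hc ?_) le_rfl
    rw [← DFunLike.coe_injective h, sub_sub_cancel]
    exact q.2
  have hWt : W = ⊤ := by simpa using hW
  rw [hWt, top_le_iff] at hle
  rw [hle, disjoint_top] at hind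
  refine hμ (le_bot_iff.mp ?_)
  rw [← hind]
  exact weightSpace_le_genWeightSpace V _

end HighestWeightModule

/-! ### Positivity from the Cartan matrix -/

namespace RootPairing.Base

open Matrix

variable {ι R M N : Type*} [CommRing R] [AddCommGroup M] [Module R M] [AddCommGroup N] [Module R N]
  {P : RootPairing ι R M N} (b : P.Base)

/-- The integral linear combination of simple roots with given coefficients. -/
def intCombination : (b.support → ℤ) →ₗ[ℤ] M :=
  Fintype.linearCombination ℤ fun i : b.support ↦ P.root i

lemma intCombination_apply (c : b.support → ℤ) : b.intCombination c = ∑ i, c i • P.root i :=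
  rfl

lemma intCombination_single [DecidableEq b.support] (i : b.support) (z : ℤ) :
    b.intCombination (Pi.single i z) = z • P.root i := by
  simp [intCombination, Fintype.linearCombination_apply_single]

lemma mem_rootSpan_int_iff {x : M} : x ∈ P.rootSpan ℤ ↔ ∃ c, b.intCombination c = x := by
  rw [← LinearMap.mem_range, intCombination, Fintype.range_linearCombination, rootSpan,
    ← b.span_int_root_support, Set.image_eq_range]
  rfl

lemma exists_intCombination_eq_of_mem_closure {x : M}
    (hx : x ∈ AddSubmonoid.closure (P.root '' b.support)) :
    ∃ c, 0 ≤ c ∧ b.intCombination c = x := by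
  classical
  induction hx using AddSubmonoid.closure_induction with
  | mem x hx =>
    obtain ⟨i, hi, rfl⟩ := hx
    exact ⟨Pi.single ⟨i, hi⟩ 1, by simp [Pi.single_nonneg], by simp [intCombination_single]⟩
  | zero => exact ⟨0, le_rfl, map_zero _⟩
  | add x y _ _ hx hy =>
    obtain ⟨c, hc, rfl⟩ := hx
    obtain ⟨d, hd, rfl⟩ := hy
    exact ⟨c + d, add_nonneg hc hd, map_add _ _ _⟩

variable [P.IsCrystallographic]

lemma coroot'_intCombination (c : b.support → ℤ) (j : b.support) :
    P.coroot' j (b.intCombination c) = ((c ᵥ* b.cartanMatrix) j : ℤ) := by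
  simp only [intCombination_apply, map_sum, map_zsmul, vecMul, dotProduct, Int.cast_sum,
    Int.cast_mul, zsmul_eq_mul, root_coroot'_eq_pairing]
  refine Finset.sum_congr rfl fun i _ ↦ ?_
  rw [← b.algebraMap_cartanMatrixIn_apply ℤ, eq_intCast]

variable [IsDomain R] [CharZero R] [Finite ι] [P.IsRootSystem]

/-- A positive diagonal rescaling makes the Cartan matrix positive definite, so some term of the
quadratic form at `c` is positive. -/
lemma exists_pos_mul_vecMul_cartanMatrix {c : b.support → ℤ} (hc : c ≠ 0) :
    ∃ j, 0 < c j * (c ᵥ* b.cartanMatrix) j := by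
  classical
  obtain ⟨d, hd, hpd⟩ := b.exists_cartanMatrix_mul_diagaonal_posDef
  have h := hpd.dotProduct_mulVec_pos hc
  by_contra! hle
  refine h.not_ge ?_
  rw [star_trivial, dotProduct_mulVec, ← vecMul_vecMul, dotProduct]
  refine Finset.sum_nonpos fun j _ ↦ ?_
  rw [vecMul_diagonal]
  nlinarith [hle j, hd j]

/-- Dominant elements of the root lattice are non-negative combinations of simple roots. -/
lemma nonneg_of_vecMul_cartanMatrix_nonneg {z : b.support → ℤ}
    (hz : ∀ j, 0 ≤ (z ᵥ* b.cartanMatrix) j) : 0 ≤ z := by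
  by_contra hneg
  have hc : z⁻ ≠ 0 := by rwa [ne_eq, negPart_eq_zero]
  obtain ⟨j, hj⟩ := b.exists_pos_mul_vecMul_cartanMatrix hc
  have hzj : 0 < z⁻ j := by
    refine lt_of_le_of_ne (negPart_nonneg z j) fun h ↦ ?_
    simp [← h] at hj
  have h₁ : 0 < (z⁻ ᵥ* b.cartanMatrix) j := pos_of_mul_pos_right hj hzj.le
  have h₂ : z⁺ ᵥ* b.cartanMatrix = z ᵥ* b.cartanMatrix + z⁻ ᵥ* b.cartanMatrix := by
    rw [← add_vecMul]
    congr 1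
    exact (sub_eq_iff_eq_add.mp (posPart_sub_negPart z))
  -- Since `z j < 0`, only off-diagonal entries contribute, and these are non-positive; yet `h₂`
  -- makes the sum positive.
  have h₃ : (z⁺ ᵥ* b.cartanMatrix) j ≤ 0 := by
    refine Finset.sum_nonpos fun i _ ↦ ?_
    rcases eq_or_ne i j with rfl | hij
    · have : z⁺ i = 0 := by
        rw [Pi.negPart_apply] at hzj
        rw [Pi.posPart_apply]
        exact posPart_eq_zero.mpr (negPart_pos_iff.mp hzj).le
      simp [this]
    · exact mul_nonpos_of_nonneg_of_nonpos (posPart_nonneg z i)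
        (b.cartanMatrix_le_zero_of_ne i j hij)
  have h₄ := congrFun h₂ j
  rw [Pi.add_apply] at h₄
  linarith [hz j]

/-- For an irreducible root system, nonzero dominant elements of the root lattice are strictly
positive combinations of simple roots. -/
lemma pos_of_vecMul_cartanMatrix_nonneg [P.IsReduced] [P.IsIrreducible] {z : b.support → ℤ}
    (hz0 : z ≠ 0) (hz : ∀ j, 0 ≤ (z ᵥ* b.cartanMatrix) j) (j : b.support) : 0 < z j := by
  have hnn := b.nonneg_of_vecMul_cartanMatrix_nonneg hz
  obtain ⟨i, hi⟩ := Function.ne_iff.mp hz0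
  -- Positivity spreads along the connected Dynkin diagram: a zero coefficient next to a positive
  -- one would make the pairing at `j` negative.
  refine b.induction_on_cartanMatrix (fun j ↦ 0 < z j) (lt_of_le_of_ne (hnn i) (Ne.symm hi)) ?_
  intro i j hi hij
  refine lt_of_le_of_ne (hnn j) fun hj ↦ (hz j).not_gt ?_
  have hj : z j = 0 := hj.symm
  have hne : i ≠ j := by rintro rfl; omega
  refine Finset.sum_neg' (fun k _ ↦ ?_) ⟨i, Finset.mem_univ _, ?_⟩
  · rcases eq_or_ne k j with rfl | hkj
    · simp [hj]
    · exact mul_nonpos_of_nonneg_of_nonpos (hnn k) (b.cartanMatrix_le_zero_of_ne k j hkj)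
  · refine mul_neg_of_pos_of_neg hi (lt_of_le_of_ne (b.cartanMatrix_le_zero_of_ne i j hne) ?_)
    rwa [ne_eq, b.cartanMatrix_apply_eq_zero_iff_symm]

end RootPairing.Base

/-! ### Integral weights and dominant representatives -/

namespace RootPairing

variable {ι R M N : Type*} [CommRing R] [AddCommGroup M] [Module R M] [AddCommGroup N] [Module R N]
  {P : RootPairing ι R M N}

lemma finite_weylGroup [Finite ι] [P.IsRootSystem] : Finite P.weylGroup := by
  refine Finite.of_injective P.weylGroupToPerm fun g g' h ↦ ?_
  refine Subtype.ext (Equiv.weightHom_injective P (LinearEquiv.toLinearMap_injective ?_))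
  refine LinearMap.ext_on_range (v := P.root) IsRootSystem.span_root_eq_top fun i ↦ ?_
  change g • P.root i = g' • P.root i
  rw [weylGroup_apply_root, weylGroup_apply_root, h]

/-- The elements of the weight space on which all coroots take integer values. -/
def IsIntegralWeight (P : RootPairing ι R M N) (μ : M) : Prop :=
  ∀ i, ∃ m : ℤ, P.coroot' i μ = m

lemma IsIntegralWeight.add_mem_rootSpan [P.IsCrystallographic] {μ ν : M}
    (hμ : P.IsIntegralWeight μ) (h : ν - μ ∈ P.rootSpan ℤ) : P.IsIntegralWeight ν := by
  intro i
  obtain ⟨m, hm⟩ := hμ i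
  obtain ⟨k, hk⟩ := P.coroot'_apply_apply_mem_of_mem_span ℤ h i
  refine ⟨m + k, ?_⟩
  rw [← sub_add_cancel ν μ, map_add, hm, ← hk]
  simp [add_comm]

lemma weylGroup_smul_sub_mem_rootSpan [P.IsCrystallographic] (w : P.weylGroup) {μ : M}
    (hμ : P.IsIntegralWeight μ) : w • μ - μ ∈ P.rootSpan ℤ := by
  obtain ⟨w, hw⟩ := w
  induction hw using weylGroup.induction generalizing μ with
  | mem i =>
    obtain ⟨m, hm⟩ := hμ i
    change P.reflection i μ - μ ∈ _
    rw [reflection_apply, hm, sub_sub_cancel_left, Int.cast_smul_eq_zsmul, neg_mem_iff]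
    exact Submodule.smul_mem _ _ (Submodule.subset_span ⟨i, rfl⟩)
  | one => simp
  | mul x y hx hy ihx ihy =>
    have h := ihy hμ
    have h' := ihx (hμ.add_mem_rootSpan h)
    rw [← mul_smul] at h'
    simpa using add_mem h' h

/-- Every Weyl group orbit of integral weights contains a dominant weight. -/
lemma Base.exists_weylGroup_smul_dominant {K : Type*} [Field K] [Module K M] [Module K N]
    [CharZero K] [Finite ι] {P : RootPairing ι K M N} [P.IsRootSystem] [P.IsCrystallographic]
    (b : P.Base) {μ : M} (hμ : P.IsIntegralWeight μ) :
    ∃ w : P.weylGroup, ∀ j : b.support, ∃ k : ℕ, P.coroot' j (w • μ) = k := by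
  have := P.finite_weylGroup
  choose c hc using fun w : P.weylGroup ↦
    b.mem_rootSpan_int_iff.mp (weylGroup_smul_sub_mem_rootSpan w hμ)
  -- Take `w • μ - μ` of maximal height: a negative pairing `m` with a simple coroot would let that
  -- reflection raise the height by `-m`.
  obtain ⟨w, hw⟩ := Finite.exists_max fun w : P.weylGroup ↦ ∑ i, c w i
  refine ⟨w, fun j ↦ ?_⟩
  obtain ⟨m, hm⟩ := hμ.add_mem_rootSpan (weylGroup_smul_sub_mem_rootSpan w hμ) j
  suffices 0 ≤ m by
    lift m to ℕ using this
    exact ⟨m, by simpa using hm⟩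
  classical
  let s : P.weylGroup := weylGroup.ofIdx P j
  have hs : (s * w) • μ = w • μ - m • P.root j := by
    rw [mul_smul, weylGroup.ofIdx_smul, Equiv.reflection_smul, reflection_apply, hm,
      Int.cast_smul_eq_zsmul]
  have hcs : b.intCombination (c (s * w)) = b.intCombination (c w - Pi.single j m) := by
    rw [hc, hs, map_sub, hc, Base.intCombination_single]
    abel
  have hinj : Function.Injective b.intCombination :=
    LinearIndependent.fintypeLinearCombination_injective
      (b.linearIndepOn_root.restrict_scalars' ℤ)
  have h := hw (s * w)
  rw [hinj hcs] at h
  simpa using h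

end RootPairing

/-! ### Dominant weights and comparison of modules -/

section WeightsOfHighestWeightModule

open LieModule LieAlgebra LieAlgebra.IsKilling Matrix

variable {𝔤 : Type*} [LieRing 𝔤] [LieAlgebra ℂ 𝔤] [FiniteDimensional ℂ 𝔤] [LieAlgebra.IsKilling ℂ 𝔤]
  {H : LieSubalgebra ℂ 𝔤} [H.IsCartanSubalgebra] {b : (rootSystem H).Base} {l : Dual ℂ H}
  {V : Type*} [AddCommGroup V] [Module ℂ V] [LieRingModule 𝔤 V] [LieModule ℂ 𝔤 V]

lemma isIntegralWeight_of_mem_weightSet [FiniteDimensional ℂ V] {μ : Dual ℂ H}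
    (hμ : μ ∈ weightSet H V) : (rootSystem H).IsIntegralWeight μ := fun i ↦
  let ⟨m, hm, _⟩ := exists_int_and_sub_nsmul_root_mem_weightSet i hμ
  ⟨m, hm⟩

lemma exists_intCombination_eq_highestWeight_sub (hV : IsIrreducibleOfHighestWeight b l V)
    {μ : Dual ℂ H} (hμ : μ ∈ weightSet H V) : ∃ c, 0 ≤ c ∧ b.intCombination c = l - μ :=
  b.exists_intCombination_eq_of_mem_closure (highestWeight_sub_mem_closure hV hμ)

/-- Descend by simple roots, by induction on the height of `c`. Some `j` with `c j > 0` pairs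
positively with the combination, and dominance of `μ` keeps the total pairing positive, so
subtracting that root stays within the weights. -/
lemma mem_weightSet_of_add_intCombination_mem [FiniteDimensional ℂ V] {μ : Dual ℂ H}
    (hμ : IsDominantIntegral b μ) {c : b.support → ℤ} (hc : 0 ≤ c)
    (h : μ + b.intCombination c ∈ weightSet H V) : μ ∈ weightSet H V := by
  classical
  generalize hn : ∑ i, c i = n
  have hn0 : 0 ≤ n := hn ▸ Finset.sum_nonneg fun i _ ↦ hc i
  induction n, hn0 using Int.leInduction generalizing c with
  | base =>
    have : c = 0 := by
      ext i
      exact (Finset.sum_eq_zero_iff_of_nonneg fun i _ ↦ hc i).mp hn i (Finset.mem_univ i)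
    simpa [this] using h
  | succ n hn0 ih =>
    have hc0 : c ≠ 0 := by
      rintro rfl
      simp at hn
      omega
    obtain ⟨j, hj⟩ := b.exists_pos_mul_vecMul_cartanMatrix hc0
    have hcj : 0 < c j := lt_of_le_of_ne (hc j) fun h ↦ by simp [← h] at hj
    have hvj := pos_of_mul_pos_right hj hcj.le
    obtain ⟨k, hk⟩ := hμ j j.2
    have hval : (μ + b.intCombination c) ((rootSystem H).coroot j) =
        ((k + (c ᵥ* b.cartanMatrix) j : ℤ) : ℂ) := by
      rw [LinearMap.add_apply, hk]
      push_cast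
      congr 1
      exact b.coroot'_intCombination c j
    have hsub := sub_root_mem_weightSet (j : H.root) h hval (by omega)
    refine ih (c := c - Pi.single j 1) (fun i ↦ ?_) ?_ ?_
    · rcases eq_or_ne i j with rfl | hij
      · simpa using Int.add_one_le_of_lt hcj
      · simpa [hij] using hc i
    · rwa [map_sub, b.intCombination_single, one_smul, ← add_sub_assoc]
    · simp only [Pi.sub_apply, Finset.sum_sub_distrib, hn]
      simp

/-- A dominant weight which is obtained from the highest weight by subtracting simple roots is a
weight. -/
lemma mem_weightSet_of_isDominantIntegral (hV : IsIrreducibleOfHighestWeight b l V)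
    {μ : Dual ℂ H} (hμ : IsDominantIntegral b μ) {c : b.support → ℤ} (hc : 0 ≤ c)
    (h : b.intCombination c = l - μ) : μ ∈ weightSet H V := by
  have := hV.finiteDimensional
  refine mem_weightSet_of_add_intCombination_mem hμ hc ?_
  rw [h, add_sub_cancel]
  exact highestWeight_mem_weightSet hV

lemma exists_weylGroup_smul_isDominantIntegral (b : (rootSystem H).Base) {μ : Dual ℂ H}
    (hμ : (rootSystem H).IsIntegralWeight μ) :
    ∃ w : (rootSystem H).weylGroup, IsDominantIntegral b (w • μ) :=
  let ⟨w, hw⟩ := b.exists_weylGroup_smul_dominant hμ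
  ⟨w, fun i hi ↦ hw ⟨i, hi⟩⟩

lemma IsDominantIntegral.nsmul (hl : IsDominantIntegral b l) (n : ℕ) :
    IsDominantIntegral b (n • l) := fun i hi ↦
  let ⟨k, hk⟩ := hl i hi
  ⟨n * k, by rw [LinearMap.smul_apply, hk, nsmul_eq_mul, Nat.cast_mul]⟩

lemma IsDominantIntegral.vecMul_cartanMatrix_nonneg {c : b.support → ℤ}
    (h : IsDominantIntegral b (b.intCombination c)) (j : b.support) :
    0 ≤ (c ᵥ* b.cartanMatrix) j := by
  obtain ⟨k, hk⟩ := h j j.2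
  have : (((c ᵥ* b.cartanMatrix) j : ℤ) : ℂ) = (k : ℤ) := by
    rw [← b.coroot'_intCombination c j, Int.cast_natCast]
    exact hk
  rw [Int.cast_injective this]
  positivity

/-- If `n ≥ m` and `m • l`, `n • l` differ by an element of the root lattice, then `n • l` is higher
than `m • l`. -/
lemma IsDominantIntegral.exists_intCombination_eq_nsmul_sub (hl : IsDominantIntegral b l) {m n : ℕ}
    (hmn : m ≤ n) (h : n • l - m • l ∈ (rootSystem H).rootSpan ℤ) :
    ∃ c, 0 ≤ c ∧ b.intCombination c = n • l - m • l := by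
  obtain ⟨c, hc⟩ := b.mem_rootSpan_int_iff.mp h
  refine ⟨c, b.nonneg_of_vecMul_cartanMatrix_nonneg
    (IsDominantIntegral.vecMul_cartanMatrix_nonneg ?_), hc⟩
  rw [hc, ← Nat.sub_add_cancel hmn, add_nsmul, add_sub_cancel_right]
  exact hl.nsmul _

/-- The weights of an irreducible module are those of any irreducible module with higher highest
weight. -/
lemma weightSet_subset_weightSet {V' : Type*} [AddCommGroup V'] [Module ℂ V'] [LieRingModule 𝔤 V']
    [LieModule ℂ 𝔤 V'] {l' : Dual ℂ H} (hV : IsIrreducibleOfHighestWeight b l V)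
    (hV' : IsIrreducibleOfHighestWeight b l' V') {c : b.support → ℤ} (hc : 0 ≤ c)
    (h : b.intCombination c = l' - l) : weightSet H V ⊆ weightSet H V' := by
  have := hV.finiteDimensional
  have := hV'.finiteDimensional
  intro μ hμ
  obtain ⟨w, hw⟩ :=
    exists_weylGroup_smul_isDominantIntegral b (isIntegralWeight_of_mem_weightSet hμ)
  obtain ⟨d, hd, hd'⟩ :=
    exists_intCombination_eq_highestWeight_sub hV (weylGroup_smul_mem_weightSet w hμ)
  have hwμ : w • μ ∈ weightSet H V' :=
    mem_weightSet_of_isDominantIntegral hV' hw (add_nonneg hc hd) (by rw [map_add, h, hd']; abel)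
  simpa using weylGroup_smul_mem_weightSet w⁻¹ hwμ

end WeightsOfHighestWeightModule

/-! ### The chain and its union -/

theorem mainTheorem8
    {𝔤 : Type*} [LieRing 𝔤] [LieAlgebra ℂ 𝔤] [FiniteDimensional ℂ 𝔤] [LieAlgebra.IsSimple ℂ 𝔤]
    (H : LieSubalgebra ℂ 𝔤) [H.IsCartanSubalgebra]
    (b : (LieAlgebra.IsKilling.rootSystem H).Base)
    (l : Dual ℂ H) (hl : IsDominantIntegral b l) (hl0 : l ≠ 0)
    (n : ℕ → ℕ) (hn_pos : ∀ i, 0 < n i) (hn_mono : StrictMono n)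
    (hn_coset : ∀ i, n i • l ∈ rootLatticeCoset H l)
    (L : ℕ → Type*) [∀ i, AddCommGroup (L i)] [∀ i, Module ℂ (L i)]
    [∀ i, LieRingModule 𝔤 (L i)] [∀ i, LieModule ℂ 𝔤 (L i)]
    (hL : ∀ i, IsIrreducibleOfHighestWeight b (n i • l) (L i)) :
    (∀ i, weightSet H (L i) ⊆ weightSet H (L (i + 1))) ∧
      ⋃ i, weightSet H (L i) = rootLatticeCoset H l := by
  have hfd (i : ℕ) := (hL i).finiteDimensional
  replace hn_coset (i : ℕ) : n i • l - l ∈ (LieAlgebra.IsKilling.rootSystem H).rootSpan ℤ :=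
    hn_coset i
  have hQ (i j : ℕ) : n i • l - n j • l ∈ (LieAlgebra.IsKilling.rootSystem H).rootSpan ℤ := by
    simpa using sub_mem (hn_coset i) (hn_coset j)
  refine ⟨fun i ↦ ?_, Set.Subset.antisymm (Set.iUnion_subset fun i μ hμ ↦ ?_) fun μ hμ ↦ ?_⟩
  · obtain ⟨c, hc, hc'⟩ :=
      hl.exists_intCombination_eq_nsmul_sub (hn_mono i.lt_succ_self).le (hQ (i + 1) i)
    exact weightSet_subset_weightSet (hL i) (hL (i + 1)) hc hc'
  · obtain ⟨c, -, hc⟩ := exists_intCombination_eq_highestWeight_sub (hL i) hμ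
    have := sub_mem (hn_coset i) (b.mem_rootSpan_int_iff.mpr ⟨c, hc⟩)
    rwa [sub_sub, add_comm, ← sub_sub, sub_sub_cancel] at this
  replace hμ : μ - l ∈ (LieAlgebra.IsKilling.rootSystem H).rootSpan ℤ := hμ
  have hμ_int : (LieAlgebra.IsKilling.rootSystem H).IsIntegralWeight μ := by
    refine (isIntegralWeight_of_mem_weightSet
      (highestWeight_mem_weightSet (hL 0))).add_mem_rootSpan ?_
    simpa using sub_mem hμ (hn_coset 0)
  obtain ⟨w, hw⟩ := exists_weylGroup_smul_isDominantIntegral b hμ_int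
  obtain ⟨c, hc⟩ : ∃ c, b.intCombination c = n 0 • l - w • μ := by
    refine b.mem_rootSpan_int_iff.mp ?_
    simpa using sub_mem (sub_mem (hn_coset 0) hμ)
      (RootPairing.weylGroup_smul_sub_mem_rootSpan w hμ_int)
  -- `N + 1 = n 1 - n 0`, so `(N + 1) • l` is a nonzero dominant element of the root lattice.
  obtain ⟨N, hN⟩ := Nat.exists_eq_add_of_lt (hn_mono Nat.zero_lt_one)
  have hNl : (N + 1) • l = n 1 • l - n 0 • l := by
    rw [hN, add_assoc, add_nsmul _ (n 0), add_sub_cancel_left]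
  obtain ⟨z, hz⟩ := b.mem_rootSpan_int_iff.mp (hQ 1 0)
  rw [← hNl] at hz
  have hz_pos : ∀ j, 0 < z j := by
    refine b.pos_of_vecMul_cartanMatrix_nonneg ?_
      (IsDominantIntegral.vecMul_cartanMatrix_nonneg (hz ▸ hl.nsmul (N + 1)))
    rintro rfl
    rw [map_zero, eq_comm, smul_eq_zero] at hz
    exact hz.elim (by omega) hl0
  -- `K` bounds every `|c j|` and every `z j ≥ 1`, so `K • z + c ≥ 0`. The index `i` is chosen so
  -- that `i • l` is `n 0 • l` plus `K` copies of the combination `z`, and `n i ≥ i`.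
  let K : ℕ := ∑ j, (c j).natAbs
  let i := n 0 + K * (N + 1)
  have hi : n 0 + K * (N + 1) ≤ n i := hn_mono.le_apply
  have hKl : (n 0 + K * (N + 1)) • l = n 0 • l + K • b.intCombination z := by
    rw [hz, add_nsmul, mul_nsmul']
  obtain ⟨y, hy, hy'⟩ := hl.exists_intCombination_eq_nsmul_sub hi (by
    rw [hKl, ← sub_sub]
    exact sub_mem (hQ i 0) (nsmul_mem (b.mem_rootSpan_int_iff.mpr ⟨z, rfl⟩) K))
  have hyc : 0 ≤ y + (K • z + c) := by
    refine add_nonneg hy fun j ↦ ?_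
    have h₁ : (c j).natAbs ≤ K :=
      Finset.single_le_sum (f := fun j ↦ (c j).natAbs) (fun _ _ ↦ Nat.zero_le _)
        (Finset.mem_univ j)
    have h₂ : (K : ℤ) ≤ K * z j := le_mul_of_one_le_right (by positivity) (hz_pos j)
    have h₃ : (K • z + c) j = K * z j + c j := by simp
    change (0 : ℤ) ≤ (K • z + c) j
    rw [h₃]
    omega
  have hwμ : w • μ ∈ weightSet H (L i) := by
    refine mem_weightSet_of_isDominantIntegral (hL i) hw hyc ?_
    rw [map_add, map_add, map_nsmul, hc, hy', hKl]
    abel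
  refine Set.mem_iUnion.mpr ⟨i, ?_⟩
  simpa using weylGroup_smul_mem_weightSet w⁻¹ hwμ
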